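/- \textbf{Theorem.} Let $G$ be an arbitrary probability distribution on $[0,\infty)\times[0,1]$. Let $(X_i,K_i)$, $i=1,2,\dots$, be iid pairs distributed according to the mixture, over $\theta=(\lambda,p)\sim G$, of the following law: $K\sim\mathrm{Poisson}(\lambda)$ and, conditionally on $K$, $X\sim\mathrm{Binomial}(K,p)$. Put $W_{i1}=X_i$ and $W_{i2}=K_i-X_i$, and let $G_\xi$ be the distribution on $[0,\infty)^2$ of $(\xi_1,\xi_2)=(p\lambda,(1-p)\lambda)$ when $(\lambda,p)\sim G$. Then, conditionally on $(\lambda,p)$, the counts $X$ and $K-X$ are independent Poisson variables with means $\xi_1$ and $\xi_2$; so $(W_{i1},W_{i2})$ are iid from the Poisson mixture with mixing distribution $G_\xi$. For a probability distribution $H$ on $[0,\infty)^2$ let $$f_H(w_1,w_2)=\int e^{-\xi_1}\frac{\xi_1^{w_1}}{w_1!}\,e^{-\xi_2}\frac{\xi_2^{w_2}}{w_2!}\,dH(\xi_1,\xi_2).$$ For each $n$ let $\hat G_{\xi}^{(n)}$ be any generalized maximum likelihood estimator (GMLE), that is, any maximizer of $\prod_{i=1}^n f_H(W_{i1},W_{i2})$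 over all probability distributions $H$ on $[0,\infty)^2$. Then, with probability one, $\hat G_{\xi}^{(n)}$ converges weakly to $G_\xi$ as $n\to\infty$. -/

import Mathlib

open MeasureTheory ProbabilityTheory Filter Topology
open scoped NNReal ENNReal unitInterval

noncomputable section

namespace PostStrat

/-- Conditional law of the observation `(X, K)` given `θ = (lam, p)`:
`K` is Poisson with mean `lam` and, given `K = k`, `X` is binomial with parameters `k`, `p`. -/
def obsLaw (θ : ℝ≥0 × I) : Measure (ℕ × ℕ) :=
  (poissonMeasure θ.1).bind fun k => (binomial k θ.2).map fun x => (x, k)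

lemma measurable_obsLaw : Measurable obsLaw := by
  refine Measure.measurable_of_measurable_coe _ fun s _ => ?_
  have h : ∀ θ : ℝ≥0 × I, obsLaw θ s = ∑' k : ℕ,
      (∑' x : ℕ, ENNReal.ofReal ((k.choose x) * (θ.2 : ℝ) ^ x * (1 - (θ.2 : ℝ)) ^ (k - x)) *
          s.indicator (fun _ => (1 : ℝ≥0∞)) (x, k)) *
        ENNReal.ofReal (Real.exp (-(θ.1 : ℝ)) * (θ.1 : ℝ) ^ k / (k.factorial : ℝ)) := by
    intro θ
    rw [obsLaw, Measure.bind_apply .of_discrete Measurable.of_discrete.aemeasurable, lintegral_countable']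
    refine tsum_congr fun k => ?_
    rw [poissonMeasure_singleton, Measure.map_apply .of_discrete .of_discrete,
      ← lintegral_indicator_one .of_discrete, lintegral_countable']
    congr 1
    refine tsum_congr fun x => ?_
    rw [binomial_singleton, mul_comm]
    rfl
  simp_rw [h]
  fun_prop

/-- Conditional law of `(X, K)` given `θ`, as a Markov kernel. -/
def obsKernel : Kernel (ℝ≥0 × I) (ℕ × ℕ) := ⟨obsLaw, measurable_obsLaw⟩

/-- The new parameter `(ξ₁, ξ₂) = (p lam, (1 - p) lam)`. -/
def reparam (θ : ℝ≥0 × I) : ℝ≥0 × ℝ≥0 :=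
  (unitInterval.toNNReal θ.2 * θ.1, unitInterval.toNNReal (unitInterval.symm θ.2) * θ.1)

lemma measurable_reparam : Measurable reparam := by
  have h : Continuous reparam := by
    unfold reparam
    fun_prop
  exact h.measurable

/-- The law `G_ξ` of `(ξ₁, ξ₂)` when `θ` has law `G`. -/
def mixingLaw (G : ProbabilityMeasure (ℝ≥0 × I)) : ProbabilityMeasure (ℝ≥0 × ℝ≥0) :=
  G.map measurable_reparam.aemeasurable

/-- The new observation `(W₁, W₂) = (X, K - X)`. -/
def splitCounts (y : ℕ × ℕ) : ℕ × ℕ := (y.1, y.2 - y.1)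

/-- The mixture density `f_G (w) = ∫ f_ξ (w) dG(ξ)`, where `f_ξ` is the probability mass function
of two independent Poisson counts with means `ξ₁`, `ξ₂`. -/
def mixDensity (G : ProbabilityMeasure (ℝ≥0 × ℝ≥0)) (w : ℕ × ℕ) : ℝ :=
  ∫ ξ, (poissonMeasure ξ.1).real {w.1} * (poissonMeasure ξ.2).real {w.2}
    ∂(G : Measure (ℝ≥0 × ℝ≥0))

/-- `Ghat` is a generalized maximum likelihood estimator based on the data `w`: it maximizes
the likelihood among all probability measures on the parameter space. -/
def IsGMLE {n : ℕ} (w : Fin n → ℕ × ℕ) (Ghat : ProbabilityMeasure (ℝ≥0 × ℝ≥0)) : Prop :=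
  ∀ H : ProbabilityMeasure (ℝ≥0 × ℝ≥0), ∏ i, mixDensity H (w i) ≤ ∏ i, mixDensity Ghat (w i)

end PostStrat

end

/-!
By Poisson thinning (`map_splitCounts_obsLaw`) the pairs `W = (X, K - X)` are iid with probability
mass function `f`, the Poisson mixture density of the true mixing distribution `G_ξ`. Almost surely
every observation has positive probability and, by the strong law of large numbers, the relative
frequencies `p n w` converge to `f w` for each of the countably many values `w`. What remains is a
statement about a fixed data sequence, `tendsto_of_isGMLE`.

The set of mixture densities is convex, so at a GMLE with fitted density `q n` the log-likelihood has
nonpositive derivative in the direction of `f`. This says that the empirical mean of `f / q n` is at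
most one (`IsGMLE.sum_div_le`). If `p n` were equal to `f`, this would read `∑ f² / q n ≤ 1`, that
is, the chi-square distance of `f` from `q n` would vanish. With `p n → f` only, the same computation
on large finite sets still gives `q n → f` pointwise (`tendsto_of_sum_mul_div_le`), with no need for
a uniform law of large numbers.

It remains to pass from Poisson mixture densities to mixing distributions
(`tendsto_of_tendsto_mixDensity`). Up to factorials, the densities are the moments
`∫ e^{-c (ξ₁ + ξ₂)} ξ₁^a ξ₂^b` with `c = 1`. Expanding the exponential around the rate `c` yields
convergence of these moments for every rate in `(0, 2 c)`, hence, by iteration, for every `c > 0`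
(`MomentsTendsto.of_one`). Small rates control the mass far from the origin and give tightness
(`MomentsTendsto.isTightMeasureSet`). The damped monomials of all rates, together with `1`, span an
algebra of bounded continuous functions that separates points, and for a tight sequence convergence
of the integrals over such an algebra implies weak convergence.
-/

noncomputable section

namespace PostStrat

/-! ### Poisson thinning -/

/-- Poisson thinning: given `θ`, the counts `X` and `K - X` are independent Poisson variables. -/
theorem map_splitCounts_obsLaw (θ : ℝ≥0 × I) : (obsLaw θ).map splitCounts =
    (poissonMeasure (reparam θ).1).prod (poissonMeasure (reparam θ).2) := by
  obtain ⟨lam, p⟩ := θ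
  refine Measure.ext_of_singleton fun ⟨a, b⟩ => ?_
  have hk : ∀ k : ℕ, ((binomial k p).map fun x => (x, k)) (splitCounts ⁻¹' {(a, b)}) =
      ({a + b} : Set ℕ).indicator (fun _ => binomial (a + b) p {a}) k := by
    intro k
    rw [Measure.map_apply .of_discrete .of_discrete]
    by_cases h : k = a + b
    · subst h
      rw [Set.indicator_of_mem (Set.mem_singleton _)]
      congr 1
      ext x
      simp only [splitCounts, Set.mem_preimage, Set.mem_singleton_iff, Prod.mk.injEq]
      omega
    · rw [Set.indicator_of_notMem (by simpa using h)]
      -- truncated subtraction also allows `k < a` when `b = 0`; that event is binomially null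
      by_cases hb : k < a
      · refine measure_mono_null (t := {a}) (fun x hx => ?_) ?_
        · simp only [splitCounts, Set.mem_preimage, Set.mem_singleton_iff, Prod.mk.injEq] at hx ⊢
          exact hx.1
        · rw [binomial_singleton, Nat.choose_eq_zero_of_lt hb]
          simp
      · convert measure_empty (μ := binomial k p)
        ext x
        simp only [splitCounts, Set.mem_preimage, Set.mem_singleton_iff, Prod.mk.injEq,
          Set.mem_empty_iff_false, iff_false]
        omega
  have hprod : ({(a, b)} : Set (ℕ × ℕ)) = {a} ×ˢ {b} := Set.singleton_prod_singleton.symm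
  rw [Measure.map_apply .of_discrete .of_discrete, obsLaw,
    Measure.bind_apply .of_discrete Measurable.of_discrete.aemeasurable]
  simp_rw [hk]
  rw [lintegral_indicator .of_discrete, setLIntegral_const, hprod, Measure.prod_prod,
    binomial_singleton, poissonMeasure_singleton, poissonMeasure_singleton,
    poissonMeasure_singleton, ← ENNReal.ofReal_mul binomial_nonneg,
    ← ENNReal.ofReal_mul (by positivity)]
  congr 1
  have hC : ((a + b).choose a : ℝ) * (a.factorial * b.factorial) = ((a + b).factorial : ℝ) := by
    rw [← mul_assoc]
    have := Nat.choose_mul_factorial_mul_factorial (Nat.le_add_right a b)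
    rw [Nat.add_sub_cancel_left] at this
    exact_mod_cast this
  have hE : Real.exp (-(lam : ℝ)) =
      Real.exp (-((p : ℝ) * lam)) * Real.exp (-((1 - (p : ℝ)) * lam)) := by
    rw [← Real.exp_add]
    congr 1
    ring
  have h1 : (((reparam (lam, p)).1 : ℝ≥0) : ℝ) = p * lam := by simp [reparam]
  have h2 : (((reparam (lam, p)).2 : ℝ≥0) : ℝ) = (1 - p) * lam := by simp [reparam]
  have ha : (a.factorial : ℝ) ≠ 0 := by positivity
  have hb : (b.factorial : ℝ) ≠ 0 := by positivity
  have hc : ((a + b).choose a : ℝ) ≠ 0 := by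
    exact_mod_cast (Nat.choose_pos (Nat.le_add_right a b)).ne'
  rw [h1, h2, hE, ← hC, Nat.add_sub_cancel_left, mul_pow, mul_pow, pow_add]
  field_simp

/-! ### Poisson mixtures -/

/-- The probability of the count pair `w` under independent Poisson laws with means `ξ`; its
`ξ`-integral against `H` is, by definition, `mixDensity H w`. -/
def poissonProd (w : ℕ × ℕ) (ξ : ℝ≥0 × ℝ≥0) : ℝ :=
  (poissonMeasure ξ.1).real {w.1} * (poissonMeasure ξ.2).real {w.2}

lemma poissonProd_eq (w : ℕ × ℕ) (ξ : ℝ≥0 × ℝ≥0) : poissonProd w ξ =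
    ((w.1.factorial : ℝ) * w.2.factorial)⁻¹ *
      (Real.exp (-1 * (ξ.1 + ξ.2 : ℝ)) * (ξ.1 : ℝ) ^ w.1 * (ξ.2 : ℝ) ^ w.2) := by
  rw [poissonProd, poissonMeasure_real_singleton, poissonMeasure_real_singleton,
    show -1 * (ξ.1 + ξ.2 : ℝ) = -ξ.1 + -ξ.2 by ring, Real.exp_add]
  field_simp

lemma continuous_poissonProd (w : ℕ × ℕ) : Continuous (poissonProd w) := by
  simp_rw [funext (poissonProd_eq w)]
  fun_prop

lemma poissonProd_nonneg (w : ℕ × ℕ) (ξ : ℝ≥0 × ℝ≥0) : 0 ≤ poissonProd w ξ :=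
  mul_nonneg measureReal_nonneg measureReal_nonneg

lemma poissonProd_eq_real_prod (w : ℕ × ℕ) (ξ : ℝ≥0 × ℝ≥0) :
    poissonProd w ξ = ((poissonMeasure ξ.1).prod (poissonMeasure ξ.2)).real {w} := by
  rw [poissonProd, ← measureReal_prod_prod, Set.singleton_prod_singleton]

lemma sum_poissonProd_le_one (A : Finset (ℕ × ℕ)) (ξ : ℝ≥0 × ℝ≥0) :
    ∑ w ∈ A, poissonProd w ξ ≤ 1 := by
  simp_rw [poissonProd_eq_real_prod]
  rw [sum_measureReal_singleton]
  exact measureReal_le_one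

lemma poissonProd_le_one (w : ℕ × ℕ) (ξ : ℝ≥0 × ℝ≥0) : poissonProd w ξ ≤ 1 := by
  simpa using sum_poissonProd_le_one {w} ξ

lemma integrable_poissonProd (w : ℕ × ℕ) (μ : Measure (ℝ≥0 × ℝ≥0)) [IsFiniteMeasure μ] :
    Integrable (poissonProd w) μ :=
  .of_bound (continuous_poissonProd w).aestronglyMeasurable 1 (.of_forall fun ξ => by
    rw [Real.norm_of_nonneg (poissonProd_nonneg w ξ)]
    exact poissonProd_le_one w ξ)

lemma mixDensity_nonneg (H : ProbabilityMeasure (ℝ≥0 × ℝ≥0)) (w : ℕ × ℕ) : 0 ≤ mixDensity H w :=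
  integral_nonneg (poissonProd_nonneg w)

lemma sum_mixDensity_le_one (H : ProbabilityMeasure (ℝ≥0 × ℝ≥0)) (A : Finset (ℕ × ℕ)) :
    ∑ w ∈ A, mixDensity H w ≤ 1 := by
  change ∑ w ∈ A, ∫ ξ, poissonProd w ξ ∂(H : Measure (ℝ≥0 × ℝ≥0)) ≤ 1
  rw [← integral_finsetSum _ fun w _ => integrable_poissonProd w _]
  calc ∫ ξ, ∑ w ∈ A, poissonProd w ξ ∂(H : Measure (ℝ≥0 × ℝ≥0))
      ≤ ∫ _, (1 : ℝ) ∂(H : Measure (ℝ≥0 × ℝ≥0)) :=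
        integral_mono (integrable_finsetSum _ fun w _ => integrable_poissonProd w _)
          (integrable_const _) (sum_poissonProd_le_one A)
    _ = 1 := by simp

/-- Under the mixture over `θ ~ G`, the split counts have probability mass function `f_{G_ξ}`. -/
theorem bind_obsKernel_splitCounts (G : ProbabilityMeasure (ℝ≥0 × I)) (w : ℕ × ℕ) :
    ((G : Measure (ℝ≥0 × I)).bind obsKernel) (splitCounts ⁻¹' {w}) =
      ENNReal.ofReal (mixDensity (mixingLaw G) w) := by
  rw [Measure.bind_apply .of_discrete obsKernel.measurable.aemeasurable]
  have h : ∀ θ, obsKernel θ (splitCounts ⁻¹' {w}) =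
      ENNReal.ofReal (poissonProd w (reparam θ)) := by
    intro θ
    rw [poissonProd_eq_real_prod, ofReal_measureReal, ← map_splitCounts_obsLaw,
      Measure.map_apply .of_discrete .of_discrete]
    rfl
  have hint : Integrable (fun θ => poissonProd w (reparam θ)) (G : Measure (ℝ≥0 × I)) :=
    .of_bound ((continuous_poissonProd w).measurable.comp
      measurable_reparam).aestronglyMeasurable 1 (.of_forall fun θ => by
        rw [Real.norm_of_nonneg (poissonProd_nonneg w _)]
        exact poissonProd_le_one w _)
  simp_rw [h]
  rw [← ofReal_integral_eq_lintegral_ofReal hint (.of_forall fun θ => poissonProd_nonneg w _)]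
  congr 1
  change _ = ∫ ξ, poissonProd w ξ ∂((G : Measure (ℝ≥0 × I)).map reparam)
  rw [integral_map measurable_reparam.aemeasurable
    (continuous_poissonProd w).aestronglyMeasurable]

/-! ### The first-order condition for a GMLE -/

lemma exists_mixture (H₀ H₁ : ProbabilityMeasure (ℝ≥0 × ℝ≥0)) {t : ℝ} (h0 : 0 ≤ t) (h1 : t ≤ 1) :
    ∃ M : ProbabilityMeasure (ℝ≥0 × ℝ≥0), ∀ w,
      mixDensity M w = (1 - t) * mixDensity H₀ w + t * mixDensity H₁ w := by
  have ht : 0 ≤ 1 - t := by linarith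
  refine ⟨⟨ENNReal.ofReal (1 - t) • (H₀ : Measure _) + ENNReal.ofReal t • (H₁ : Measure _),
    ⟨by simp [← ENNReal.ofReal_add ht h0]⟩⟩, fun w => ?_⟩
  change ∫ ξ, poissonProd w ξ ∂(ENNReal.ofReal (1 - t) • (H₀ : Measure (ℝ≥0 × ℝ≥0)) +
    ENNReal.ofReal t • (H₁ : Measure (ℝ≥0 × ℝ≥0))) = _
  rw [integral_add_measure ((integrable_poissonProd w _).smul_measure ENNReal.ofReal_ne_top)
    ((integrable_poissonProd w _).smul_measure ENNReal.ofReal_ne_top), integral_smul_measure,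
    integral_smul_measure, ENNReal.toReal_ofReal ht, ENNReal.toReal_ofReal h0]
  rfl

/-- If a product of positive numbers does not increase along the segment from `a` to `b`, then its
logarithmic derivative at `a` towards `b`, which is `∑ (b i / a i - 1)`, is nonpositive. -/
lemma sum_div_le_of_prod_le {n : ℕ} {a b : Fin n → ℝ} (ha : ∀ i, 0 < a i)
    (h : ∀ t : ℝ, 0 ≤ t → t ≤ 1 → ∏ i, ((1 - t) * a i + t * b i) ≤ ∏ i, a i) :
    ∑ i, b i / a i ≤ n := by
  have hd : HasDerivAt (fun t : ℝ => ∏ i, (1 + t * (b i / a i - 1))) (∑ i, (b i / a i - 1)) 0 := by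
    have := HasDerivAt.fun_finsetProd (u := Finset.univ) (x := (0 : ℝ))
      (f := fun i t => 1 + t * (b i / a i - 1)) (f' := fun i => b i / a i - 1) fun i _ => by
        simpa using ((hasDerivAt_id (0 : ℝ)).mul_const (b i / a i - 1)).const_add 1
    simpa using this
  have hle : ∀ t : ℝ, 0 ≤ t → t ≤ 1 → ∏ i, (1 + t * (b i / a i - 1)) ≤ 1 := by
    intro t h0 h1
    have hpos : 0 < ∏ i, a i := Finset.prod_pos fun i _ => ha i
    refine le_of_mul_le_mul_right ?_ hpos
    rw [← Finset.prod_mul_distrib, one_mul]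
    refine le_trans (le_of_eq (Finset.prod_congr rfl fun i _ => ?_)) (h t h0 h1)
    have := (ha i).ne'
    field_simp
    ring
  have hs := hd.tendsto_slope_zero_right
  have : ∑ i, (b i / a i - 1) ≤ 0 := by
    refine le_of_tendsto hs ?_
    filter_upwards [Ioo_mem_nhdsGT (zero_lt_one' ℝ)] with t ht
    have := hle t ht.1.le ht.2.le
    simp only [zero_add, zero_mul, add_zero, Finset.prod_const_one, smul_eq_mul]
    exact mul_nonpos_of_nonneg_of_nonpos (inv_nonneg.2 ht.1.le) (by linarith)
  simpa using this

/-- First-order optimality condition for a GMLE: the directional derivative of the log-likelihood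
at the GMLE towards any other mixing distribution is nonpositive. Positivity of the fitted density
at the data excludes the junk value of division by zero. -/
theorem IsGMLE.sum_div_le {n : ℕ} {w : Fin n → ℕ × ℕ} {Ghat : ProbabilityMeasure (ℝ≥0 × ℝ≥0)}
    (h : IsGMLE w Ghat) (hpos : ∀ i, 0 < mixDensity Ghat (w i))
    (H : ProbabilityMeasure (ℝ≥0 × ℝ≥0)) :
    ∑ i, mixDensity H (w i) / mixDensity Ghat (w i) ≤ n := by
  refine sum_div_le_of_prod_le hpos fun t h0 h1 => ?_
  obtain ⟨M, hM⟩ := exists_mixture Ghat H h0 h1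
  simpa [hM] using h M

lemma IsGMLE.mixDensity_pos {n : ℕ} {w : Fin n → ℕ × ℕ} {Ghat : ProbabilityMeasure (ℝ≥0 × ℝ≥0)}
    (h : IsGMLE w Ghat) {H : ProbabilityMeasure (ℝ≥0 × ℝ≥0)} (hpos : ∀ i, 0 < mixDensity H (w i))
    (i : Fin n) : 0 < mixDensity Ghat (w i) := by
  have hlt : 0 < ∏ i, mixDensity Ghat (w i) := (Finset.prod_pos fun i _ => hpos i).trans_le (h H)
  exact (mixDensity_nonneg _ _).lt_of_ne' (Finset.prod_ne_zero_iff.1 hlt.ne' i (Finset.mem_univ i))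

/-! ### Convergence of densities from the first-order condition -/

/-- Let `f` be a probability mass function, `q n` sub-probability mass functions and `p n → f`
pointwise. If `∑_A p n * f / q n ≤ 1` for every finite `A`, then `q n → f` pointwise.
The point is that `(f - q)² ≤ (f - q)² / q = f² / q - 2 f + q` as `q ≤ 1`. Summed over `A`, and with
`f² / q` replaced by `p n * f / q`, this gives `∑_A (f - q)² ≤ 2 (1 - f(A)) + o(1)`, where `f(A)` may
be taken as close to `1` as desired. -/
theorem tendsto_of_sum_mul_div_le {α : Type*} {f : α → ℝ} {p q : ℕ → α → ℝ}
    (hf0 : ∀ w, 0 ≤ f w) (hf : HasSum f 1) (hq0 : ∀ n w, 0 ≤ q n w)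
    (hq : ∀ n (A : Finset α), ∑ w ∈ A, q n w ≤ 1)
    (hp : ∀ w, Tendsto (fun n => p n w) atTop (𝓝 (f w)))
    (hpq : ∀ n w, 0 < p n w → 0 < q n w)
    (hle : ∀ n (A : Finset α), ∑ w ∈ A, p n w * (f w / q n w) ≤ 1) (w : α) :
    Tendsto (fun n => q n w) atTop (𝓝 (f w)) := by
  classical
  have hq1 : ∀ n w, q n w ≤ 1 := fun n w => by simpa using hq n {w}
  -- the error term comes from replacing `f * (f / q n)` by `p n * (f / q n)`, as `f / q n ≤ 1 / p n`
  have key : ∀ A : Finset α, ∀ᶠ n in atTop, ∑ v ∈ A, (f v - q n v) ^ 2 ≤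
      (2 - 2 * ∑ v ∈ A, f v) + ∑ v ∈ A, if f v = 0 then 0 else |f v - p n v| / p n v := by
    intro A
    have hev : ∀ᶠ n in atTop, ∀ v ∈ A, f v = 0 ∨ 0 < p n v := by
      rw [Filter.eventually_all_finset]
      intro v _
      rcases (hf0 v).eq_or_lt with h | h
      · exact .of_forall fun n => .inl h.symm
      · filter_upwards [(hp v).eventually_const_lt h] with n hn using .inr hn
    filter_upwards [hev] with n hn
    have hterm : ∀ v ∈ A, (f v - q n v) ^ 2 ≤ p n v * (f v / q n v) +
        (if f v = 0 then 0 else |f v - p n v| / p n v) - 2 * f v + q n v := by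
      intro v hv
      by_cases h0 : f v = 0
      · rw [if_pos h0, h0]
        have := hq0 n v
        have := hq1 n v
        simp only [zero_div, mul_zero]
        nlinarith
      · rw [if_neg h0]
        have hpv := (hn v hv).resolve_left h0
        have hqv := hpq n v hpv
        have h1 : p n v * (f v / q n v) ≤ 1 := by simpa using hle n {v}
        have h2 : f v / q n v ≤ 1 / p n v := by
          rw [le_div_iff₀ hpv]
          linarith
        have h3 : (f v - p n v) * (f v / q n v) ≤ |f v - p n v| / p n v := by
          calc (f v - p n v) * (f v / q n v) ≤ |f v - p n v| * (f v / q n v) :=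
                mul_le_mul_of_nonneg_right (le_abs_self _) (div_nonneg (hf0 v) hqv.le)
            _ ≤ |f v - p n v| * (1 / p n v) := mul_le_mul_of_nonneg_left h2 (abs_nonneg _)
            _ = _ := by ring
        have h4 : (f v - q n v) ^ 2 ≤ (f v - q n v) ^ 2 / q n v := by
          rw [le_div_iff₀ hqv]
          exact mul_le_of_le_one_right (sq_nonneg _) (hq1 n v)
        have h5 : (f v - q n v) ^ 2 / q n v = f v * (f v / q n v) - 2 * f v + q n v := by
          field_simp
          ring
        nlinarith
    refine (Finset.sum_le_sum hterm).trans ?_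
    rw [Finset.sum_add_distrib, Finset.sum_sub_distrib, Finset.sum_add_distrib, ← Finset.mul_sum]
    linarith [hle n A, hq n A]
  have herr : ∀ A : Finset α, Tendsto (fun n => ∑ v ∈ A,
      if f v = 0 then 0 else |f v - p n v| / p n v) atTop (𝓝 0) := by
    intro A
    rw [← Finset.sum_const_zero (s := A) (ι := α)]
    refine tendsto_finsetSum _ fun v _ => ?_
    by_cases h0 : f v = 0
    · simp [h0]
    · simpa [h0, Pi.div_def] using
        ((tendsto_const_nhds (x := f v)).sub (hp v)).abs.div (hp v) h0
  have hsq : Tendsto (fun n => (f w - q n w) ^ 2) atTop (𝓝 0) := by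
    rw [tendsto_order]
    refine ⟨fun a ha => .of_forall fun n => ha.trans_le (sq_nonneg _), fun ε hε => ?_⟩
    obtain ⟨A, hA⟩ := ((hf.eventually_const_lt (show 1 - ε / 4 < 1 by linarith)).and
      (eventually_ge_atTop {w})).exists
    filter_upwards [key A, (herr A).eventually_lt_const (half_pos hε)] with n h1 h2
    have h3 : (f w - q n w) ^ 2 ≤ ∑ v ∈ A, (f v - q n v) ^ 2 :=
      Finset.single_le_sum (f := fun v => (f v - q n v) ^ 2) (fun v _ => sq_nonneg _)
        (Finset.singleton_subset_iff.1 hA.2)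
    linarith [hA.1]
  have habs : Tendsto (fun n => |f w - q n w|) atTop (𝓝 0) := by
    simpa [Real.sqrt_sq_eq_abs] using hsq.sqrt
  have := (tendsto_zero_iff_abs_tendsto_zero _).2 habs
  simpa using tendsto_const_nhds (x := f w) |>.sub this

/-! ### Exponentially damped moments -/

/-- The exponentially damped monomial `e^{-c (ξ₁ + ξ₂)} ξ₁^a ξ₂^b (ξ₁ + ξ₂)^k`. -/
def expMonomial (c : ℝ) (a b k : ℕ) (ξ : ℝ≥0 × ℝ≥0) : ℝ :=
  Real.exp (-c * (ξ.1 + ξ.2 : ℝ)) * (ξ.1 : ℝ) ^ a * (ξ.2 : ℝ) ^ b * (ξ.1 + ξ.2 : ℝ) ^ k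

lemma continuous_expMonomial (c : ℝ) (a b k : ℕ) : Continuous (expMonomial c a b k) := by
  unfold expMonomial
  fun_prop

lemma expMonomial_nonneg (c : ℝ) (a b k : ℕ) (ξ : ℝ≥0 × ℝ≥0) : 0 ≤ expMonomial c a b k ξ := by
  unfold expMonomial
  positivity

/-- Uniform bound, from `(c s)^m / m! ≤ e^{c s}` with `s = ξ₁ + ξ₂` and `m = a + b + k`. -/
lemma expMonomial_le {c : ℝ} (hc : 0 < c) (a b k : ℕ) (ξ : ℝ≥0 × ℝ≥0) :
    expMonomial c a b k ξ ≤ (a + b + k).factorial / c ^ (a + b + k) := by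
  obtain ⟨x, y⟩ := ξ
  have hs : (0 : ℝ) ≤ x + y := by positivity
  have h1 : (c * (x + y : ℝ)) ^ (a + b + k) / (a + b + k).factorial ≤ Real.exp (c * (x + y : ℝ)) :=
    Real.pow_div_factorial_le_exp _ (by positivity) _
  have h2 : (x : ℝ) ^ a * (y : ℝ) ^ b * (x + y : ℝ) ^ k ≤ (x + y : ℝ) ^ (a + b + k) := by
    rw [pow_add, pow_add]
    gcongr <;> simp
  rw [le_div_iff₀ (by positivity)]
  calc expMonomial c a b k (x, y) * c ^ (a + b + k)
      = Real.exp (-(c * (x + y : ℝ))) * ((x : ℝ) ^ a * (y : ℝ) ^ b * (x + y : ℝ) ^ k) *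
          c ^ (a + b + k) := by
        rw [expMonomial, neg_mul]
        ring
    _ ≤ Real.exp (-(c * (x + y : ℝ))) * (x + y : ℝ) ^ (a + b + k) * c ^ (a + b + k) := by gcongr
    _ = Real.exp (-(c * (x + y : ℝ))) * (c * (x + y : ℝ)) ^ (a + b + k) := by
        rw [mul_pow]
        ring
    _ ≤ Real.exp (-(c * (x + y : ℝ))) *
          (Real.exp (c * (x + y : ℝ)) * (a + b + k).factorial) := by
        rw [div_le_iff₀ (by positivity)] at h1
        gcongr
    _ = (a + b + k).factorial := by
        rw [← mul_assoc, ← Real.exp_add]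
        simp

lemma integrable_expMonomial {c : ℝ} (hc : 0 < c) (a b k : ℕ) (μ : Measure (ℝ≥0 × ℝ≥0))
    [IsFiniteMeasure μ] : Integrable (expMonomial c a b k) μ :=
  .of_bound (continuous_expMonomial c a b k).aestronglyMeasurable _ (.of_forall fun ξ => by
    rw [Real.norm_of_nonneg (expMonomial_nonneg c a b k ξ)]
    exact expMonomial_le hc a b k ξ)

lemma integral_expMonomial_succ {c : ℝ} (hc : 0 < c) (a b k : ℕ) (μ : Measure (ℝ≥0 × ℝ≥0))
    [IsFiniteMeasure μ] : ∫ ξ, expMonomial c a b (k + 1) ξ ∂μ =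
      ∫ ξ, expMonomial c (a + 1) b k ξ ∂μ + ∫ ξ, expMonomial c a (b + 1) k ξ ∂μ := by
  rw [← integral_add (integrable_expMonomial hc _ _ _ _) (integrable_expMonomial hc _ _ _ _)]
  congr 1 with ξ
  simp only [expMonomial]
  ring

/-- The summand dominates, uniformly over mixing distributions, the `k`-th term of the expansion in
`hasSum_integral_expMonomial`. -/
lemma summable_expMonomial_bound {c c' : ℝ} (hc : 0 < c) (h : |c - c'| < c) (m : ℕ) :
    Summable fun k : ℕ => |c - c'| ^ k / k.factorial * ((m + k).factorial / c ^ (m + k)) := by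
  have hr : ‖|c - c'| / c‖ < 1 := by
    rw [Real.norm_of_nonneg (by positivity), div_lt_one hc]
    exact h
  refine ((summable_descFactorial_mul_geometric_of_norm_lt_one m hr).mul_right
    (1 / c ^ m)).congr fun k => ?_
  have : ((m + k).factorial : ℝ) = k.factorial * ((k + m).descFactorial m) := by
    have := Nat.factorial_mul_descFactorial (Nat.le_add_left m k)
    rw [Nat.add_sub_cancel, add_comm k m] at this
    rw [add_comm k m]
    exact_mod_cast this.symm
  rw [this, div_pow, pow_add]
  have hk : (k.factorial : ℝ) ≠ 0 := by positivity
  field_simp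

/-- Change of damping rate, by integrating `e^{-c' s} = e^{-c s} ∑ k, ((c - c') s)^k / k!` term by
term, where `s = ξ₁ + ξ₂`. -/
lemma hasSum_integral_expMonomial {c c' : ℝ} (hc : 0 < c) (h : |c - c'| < c) (a b : ℕ)
    (μ : Measure (ℝ≥0 × ℝ≥0)) [IsProbabilityMeasure μ] :
    HasSum (fun k : ℕ => (c - c') ^ k / k.factorial * ∫ ξ, expMonomial c a b k ξ ∂μ)
      (∫ ξ, expMonomial c' a b 0 ξ ∂μ) := by
  have hF : ∀ k : ℕ, Integrable
      (fun ξ => (c - c') ^ k / k.factorial * expMonomial c a b k ξ) μ :=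
    fun k => (integrable_expMonomial hc a b k μ).const_mul _
  have hsum : Summable fun k : ℕ =>
      ∫ ξ, ‖(c - c') ^ k / k.factorial * expMonomial c a b k ξ‖ ∂μ := by
    refine .of_nonneg_of_le (fun k => integral_nonneg fun ξ => norm_nonneg _) (fun k => ?_)
      (summable_expMonomial_bound hc h (a + b))
    have hb : ∀ ξ, ‖(c - c') ^ k / k.factorial * expMonomial c a b k ξ‖ ≤
        |c - c'| ^ k / k.factorial * ((a + b + k).factorial / c ^ (a + b + k)) := by
      intro ξ
      rw [norm_mul, Real.norm_of_nonneg (expMonomial_nonneg c a b k ξ), norm_div, norm_pow,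
        Real.norm_eq_abs, Real.norm_natCast]
      exact mul_le_mul_of_nonneg_left (expMonomial_le hc a b k ξ) (by positivity)
    simpa using integral_mono (hF k).norm (integrable_const _) hb
  have := hasSum_integral_of_summable_integral_norm hF hsum
  have he : ∀ ξ, HasSum (fun k : ℕ => (c - c') ^ k / k.factorial * expMonomial c a b k ξ)
      (expMonomial c' a b 0 ξ) := by
    intro ξ
    have h1 := (NormedSpace.expSeries_div_hasSum_exp ((c - c') * (ξ.1 + ξ.2 : ℝ))).mul_left
      (expMonomial c a b 0 ξ)
    rw [← Real.exp_eq_exp_ℝ] at h1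
    have h2 : expMonomial c' a b 0 ξ =
        expMonomial c a b 0 ξ * Real.exp ((c - c') * (ξ.1 + ξ.2 : ℝ)) := by
      simp only [expMonomial]
      rw [show -c' * (ξ.1 + ξ.2 : ℝ) = -c * (ξ.1 + ξ.2 : ℝ) + (c - c') * (ξ.1 + ξ.2 : ℝ) by ring,
        Real.exp_add]
      ring
    have h3 : ∀ k : ℕ, (c - c') ^ k / k.factorial * expMonomial c a b k ξ =
        expMonomial c a b 0 ξ * (((c - c') * (ξ.1 + ξ.2 : ℝ)) ^ k / k.factorial) := by
      intro k
      simp only [expMonomial, mul_pow]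
      ring
    simpa only [h2, h3] using h1
  simpa only [integral_const_mul, fun ξ => (he ξ).tsum_eq] using this

/-- Convergence of the damped moments `∫ e^{-c (ξ₁ + ξ₂)} ξ₁^a ξ₂^b dμ n` to those of `μ₀`, for all
exponents `a`, `b` and a fixed rate `c`. The factor `(ξ₁ + ξ₂)^k` of `expMonomial` is absent
(`k = 0`), since its powers expand into these moments. -/
def MomentsTendsto (μ : ℕ → ProbabilityMeasure (ℝ≥0 × ℝ≥0))
    (μ₀ : ProbabilityMeasure (ℝ≥0 × ℝ≥0)) (c : ℝ) : Prop :=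
  ∀ a b, Tendsto (fun n => ∫ ξ, expMonomial c a b 0 ξ ∂(μ n : Measure (ℝ≥0 × ℝ≥0))) atTop
    (𝓝 (∫ ξ, expMonomial c a b 0 ξ ∂(μ₀ : Measure (ℝ≥0 × ℝ≥0))))

variable {μ : ℕ → ProbabilityMeasure (ℝ≥0 × ℝ≥0)} {μ₀ : ProbabilityMeasure (ℝ≥0 × ℝ≥0)}

lemma MomentsTendsto.tendsto {c : ℝ} (hc : 0 < c) (h : MomentsTendsto μ μ₀ c) (a b k : ℕ) :
    Tendsto (fun n => ∫ ξ, expMonomial c a b k ξ ∂(μ n : Measure (ℝ≥0 × ℝ≥0))) atTop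
      (𝓝 (∫ ξ, expMonomial c a b k ξ ∂(μ₀ : Measure (ℝ≥0 × ℝ≥0)))) := by
  induction k generalizing a b with
  | zero => exact h a b
  | succ k ih =>
    simp_rw [integral_expMonomial_succ hc]
    exact (ih _ _).add (ih _ _)

lemma MomentsTendsto.change_rate {c c' : ℝ} (hc : 0 < c) (h : MomentsTendsto μ μ₀ c)
    (hcc : |c - c'| < c) : MomentsTendsto μ μ₀ c' := by
  intro a b
  simp_rw [← (hasSum_integral_expMonomial hc hcc a b _).tsum_eq]
  refine tendsto_tsum_of_dominated_convergence (summable_expMonomial_bound hc hcc (a + b))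
    (fun k => (h.tendsto hc a b k).const_mul _) (.of_forall fun n k => ?_)
  have h0 : 0 ≤ ∫ ξ, expMonomial c a b k ξ ∂(μ n : Measure (ℝ≥0 × ℝ≥0)) :=
    integral_nonneg (expMonomial_nonneg c a b k)
  have h1 : ∫ ξ, expMonomial c a b k ξ ∂(μ n : Measure (ℝ≥0 × ℝ≥0)) ≤
      (a + b + k).factorial / c ^ (a + b + k) := by
    simpa using integral_mono (integrable_expMonomial hc a b k (μ n : Measure (ℝ≥0 × ℝ≥0)))
      (integrable_const _) (expMonomial_le hc a b k)
  rw [norm_mul, Real.norm_of_nonneg h0, norm_div, norm_pow, Real.norm_eq_abs, Real.norm_natCast]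
  exact mul_le_mul_of_nonneg_left h1 (by positivity)

/-- One change of rate reaches every `c' < 2 c`, so the rates `(3 / 2) ^ m` are reached from `1`, and
from them every positive rate. -/
lemma MomentsTendsto.of_one (h : MomentsTendsto μ μ₀ 1) {c : ℝ} (hc : 0 < c) :
    MomentsTendsto μ μ₀ c := by
  have hpow : ∀ m : ℕ, MomentsTendsto μ μ₀ ((3 / 2 : ℝ) ^ m) := by
    intro m
    induction m with
    | zero => simpa using h
    | succ m ih =>
      have hm : (0 : ℝ) < (3 / 2) ^ m := by positivity
      refine ih.change_rate hm ?_
      rw [pow_succ, abs_lt]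
      constructor <;> linarith
  obtain ⟨m, hm⟩ := pow_unbounded_of_one_lt c (show (1 : ℝ) < 3 / 2 by norm_num)
  refine (hpow m).change_rate (by positivity) ?_
  rw [abs_lt]
  constructor <;> linarith

/-- Up to the factor `a! b!`, the Poisson mixture probabilities are the damped moments at rate `1`. -/
lemma momentsTendsto_one_of_mixDensity
    (h : ∀ w, Tendsto (fun n => mixDensity (μ n) w) atTop (𝓝 (mixDensity μ₀ w))) :
    MomentsTendsto μ μ₀ 1 := by
  intro a b
  have heq : ∀ H : ProbabilityMeasure (ℝ≥0 × ℝ≥0),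
      ∫ ξ, expMonomial 1 a b 0 ξ ∂(H : Measure (ℝ≥0 × ℝ≥0)) =
        ((a.factorial : ℝ) * b.factorial) * mixDensity H (a, b) := by
    intro H
    change _ = _ * ∫ ξ, poissonProd (a, b) ξ ∂(H : Measure (ℝ≥0 × ℝ≥0))
    rw [← integral_const_mul]
    congr 1 with ξ
    rw [poissonProd_eq, mul_inv_cancel_left₀ (by positivity)]
    simp [expMonomial]
  simp_rw [heq]
  exact (h (a, b)).const_mul _

/-! ### Weak convergence from damped moments -/

/-- For a sequence of probability measures on a Polish space, tightness need only be checked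
eventually, as each single measure is tight. -/
lemma isTightMeasureSet_of_eventually {E : Type*} [MeasurableSpace E] [TopologicalSpace E]
    [PolishSpace E] [BorelSpace E] {ν : ℕ → ProbabilityMeasure E}
    (h : ∀ ε : ℝ≥0∞, 0 < ε → ∃ K : Set E, IsCompact K ∧
      ∀ᶠ n in atTop, (ν n : Measure E) Kᶜ ≤ ε) :
    IsTightMeasureSet {(ν n : Measure E) | n} := by
  rw [isTightMeasureSet_iff_exists_isCompact_measure_compl_le]
  intro ε hε
  obtain ⟨K, hK, hev⟩ := h ε hε
  obtain ⟨N, hN⟩ := eventually_atTop.1 hev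
  let := TopologicalSpace.upgradeIsCompletelyMetrizable E
  have hsingle : ∀ n, ∃ L : Set E, IsCompact L ∧ (ν n : Measure E) Lᶜ ≤ ε := by
    intro n
    have ht : IsTightMeasureSet {(ν n : Measure E)} := isTightMeasureSet_singleton
    rw [isTightMeasureSet_iff_exists_isCompact_measure_compl_le] at ht
    simpa using ht ε hε
  choose L hL hLε using hsingle
  refine ⟨K ∪ ⋃ n ∈ Finset.range N, L n, hK.union ((Finset.range N).isCompact_biUnion
    fun n _ => hL n), ?_⟩
  rintro _ ⟨n, rfl⟩
  rcases lt_or_ge n N with hn | hn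
  · refine (measure_mono (Set.compl_subset_compl.2 ?_)).trans (hLε n)
    exact (Set.subset_biUnion_of_mem (u := L) (Finset.mem_coe.2 (Finset.mem_range.2 hn))).trans
      Set.subset_union_right
  · exact (measure_mono (Set.compl_subset_compl.2 Set.subset_union_left)).trans (hN n hn)

/-- The Laplace transform of a probability measure tends to `1` as its argument tends to `0`. -/
lemma exists_laplace_gt (μ₀ : ProbabilityMeasure (ℝ≥0 × ℝ≥0)) {δ : ℝ} (hδ : 0 < δ) :
    ∃ u : ℝ, 0 < u ∧ 1 - δ < ∫ ξ, expMonomial u 0 0 0 ξ ∂(μ₀ : Measure (ℝ≥0 × ℝ≥0)) := by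
  have ht : Tendsto (fun m : ℕ => ∫ ξ, expMonomial (1 / ((m : ℝ) + 1)) 0 0 0 ξ
      ∂(μ₀ : Measure (ℝ≥0 × ℝ≥0))) atTop (𝓝 (∫ _, (1 : ℝ) ∂(μ₀ : Measure (ℝ≥0 × ℝ≥0)))) := by
    refine tendsto_integral_of_dominated_convergence (fun _ => 1)
      (fun m => (continuous_expMonomial _ 0 0 0).aestronglyMeasurable) (integrable_const _)
      (fun m => .of_forall fun ξ => ?_) (.of_forall fun ξ => ?_)
    · rw [Real.norm_of_nonneg (expMonomial_nonneg _ 0 0 0 ξ)]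
      simpa using expMonomial_le (Nat.one_div_pos_of_nat (α := ℝ) (n := m)) 0 0 0 ξ
    · have h1 : Tendsto (fun m : ℕ => Real.exp (-(1 / ((m : ℝ) + 1)) * (ξ.1 + ξ.2 : ℝ))) atTop
          (𝓝 (Real.exp (-0 * (ξ.1 + ξ.2 : ℝ)))) :=
        (Real.continuous_exp.tendsto _).comp
          (tendsto_one_div_add_atTop_nhds_zero_nat.neg.mul_const _)
      simpa [expMonomial] using h1
  obtain ⟨m, hm⟩ := (ht.eventually_const_lt (u := 1 - δ) (by simpa using hδ)).exists
  exact ⟨_, Nat.one_div_pos_of_nat, hm⟩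

lemma MomentsTendsto.isTightMeasureSet (h : MomentsTendsto μ μ₀ 1) :
    IsTightMeasureSet {(μ n : Measure (ℝ≥0 × ℝ≥0)) | n} := by
  refine isTightMeasureSet_of_eventually fun ε hε => ?_
  obtain ⟨δ, hδ, hδε⟩ := ENNReal.lt_iff_exists_nnreal_btwn.1 hε
  have hδ' : (0 : ℝ) < δ := by exact_mod_cast hδ
  obtain ⟨u, hu, hlt⟩ := exists_laplace_gt μ₀ (half_pos hδ')
  have hui : 0 ≤ 1 / u := by positivity
  refine ⟨Set.Icc 0 (⟨1 / u, hui⟩, ⟨1 / u, hui⟩), isCompact_Icc, ?_⟩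
  filter_upwards [((h.of_one hu) 0 0).eventually_const_lt hlt] with n hn
  have hle1 : ∀ ξ, expMonomial u 0 0 0 ξ ≤ 1 := fun ξ => by simpa using expMonomial_le hu 0 0 0 ξ
  have hint := integrable_expMonomial hu 0 0 0 (μ n : Measure (ℝ≥0 × ℝ≥0))
  -- Markov's inequality for `1 - exp (-u (ξ₁ + ξ₂))`, which is at least `1/2` off the box
  have hmarkov := mul_meas_ge_le_integral_of_nonneg (μ := (μ n : Measure (ℝ≥0 × ℝ≥0)))
    (f := fun ξ => 1 - expMonomial u 0 0 0 ξ) (.of_forall fun ξ => sub_nonneg.2 (hle1 ξ))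
    ((integrable_const _).sub hint) (1 / 2)
  rw [integral_sub (integrable_const _) hint] at hmarkov
  simp only [integral_const, probReal_univ, smul_eq_mul, mul_one] at hmarkov
  refine le_trans (measure_mono (t := {ξ | 1 / 2 ≤ 1 - expMonomial u 0 0 0 ξ}) ?_)
    (le_trans ?_ hδε.le)
  · intro ξ hξ
    have hbig : 1 ≤ u * (ξ.1 + ξ.2 : ℝ) := by
      by_contra hcon
      push Not at hcon
      have hs : (ξ.1 + ξ.2 : ℝ) ≤ 1 / u := by
        rw [le_div_iff₀ hu]
        linarith
      refine hξ ⟨⟨zero_le, zero_le⟩, ?_, ?_⟩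
      · rw [← NNReal.coe_le_coe]
        exact le_trans (by simp) hs
      · rw [← NNReal.coe_le_coe]
        exact le_trans (by simp) hs
    have h1 : expMonomial u 0 0 0 ξ ≤ Real.exp (-1) := by
      simp only [expMonomial, pow_zero, mul_one]
      exact Real.exp_le_exp.2 (by linarith)
    have h2 : Real.exp (-1) ≤ 1 / 2 := by
      rw [Real.exp_neg, ← one_div]
      exact one_div_le_one_div_of_le two_pos (by linarith [Real.add_one_le_exp (1 : ℝ)])
    simp only [Set.mem_ofPred_eq]
    linarith
  · rw [← ofReal_measureReal, ← ENNReal.ofReal_coe_nnreal]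
    exact ENNReal.ofReal_le_ofReal (by linarith)

/-- The multiplicative monoid consisting of `1` and the bounded functions
`e^{-c (ξ₁ + ξ₂)} ξ₁^a ξ₂^b`, `c > 0`. -/
def dampedMonoid : Submonoid (BoundedContinuousFunction (ℝ≥0 × ℝ≥0) ℝ) where
  carrier := {g | g = 1 ∨ ∃ c : ℝ, 0 < c ∧ ∃ a b, ⇑g = expMonomial c a b 0}
  one_mem' := .inl rfl
  mul_mem' := by
    rintro g g' (rfl | ⟨c, hc, a, b, hg⟩) (rfl | ⟨c', hc', a', b', hg'⟩)
    · simp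
    · exact .inr ⟨c', hc', a', b', by simpa using hg'⟩
    · exact .inr ⟨c, hc, a, b, by simpa using hg⟩
    · refine .inr ⟨c + c', add_pos hc hc', a + a', b + b', ?_⟩
      funext ξ
      simp only [BoundedContinuousFunction.coe_mul, Pi.mul_apply, hg, hg', expMonomial]
      rw [show -(c + c') * (ξ.1 + ξ.2 : ℝ) = -c * (ξ.1 + ξ.2 : ℝ) + -c' * (ξ.1 + ξ.2 : ℝ) by ring,
        Real.exp_add]
      ring

/-- The algebra generated, and in fact linearly spanned, by `dampedMonoid`. -/
def dampedAlgebra : StarSubalgebra ℝ (BoundedContinuousFunction (ℝ≥0 × ℝ≥0) ℝ) :=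
  { Algebra.adjoin ℝ (dampedMonoid : Set (BoundedContinuousFunction (ℝ≥0 × ℝ≥0) ℝ)) with
    star_mem' := fun {g} hg => by
      have : star g = g := by
        ext ξ
        simp
      rwa [this] }

lemma exists_mem_dampedAlgebra {c : ℝ} (hc : 0 < c) (a b : ℕ) :
    ∃ g ∈ dampedAlgebra, ⇑g = expMonomial c a b 0 :=
  ⟨BoundedContinuousFunction.ofNormedAddCommGroup (expMonomial c a b 0)
    (continuous_expMonomial c a b 0) _ fun ξ => by
      rw [Real.norm_of_nonneg (expMonomial_nonneg c a b 0 ξ)]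
      exact expMonomial_le hc a b 0 ξ,
    Algebra.subset_adjoin (.inr ⟨c, hc, a, b, rfl⟩), rfl⟩

lemma MomentsTendsto.tendsto_integral (h : MomentsTendsto μ μ₀ 1)
    {g : BoundedContinuousFunction (ℝ≥0 × ℝ≥0) ℝ} (hg : g ∈ dampedAlgebra) :
    Tendsto (fun n => ∫ ξ, g ξ ∂(μ n : Measure (ℝ≥0 × ℝ≥0))) atTop
      (𝓝 (∫ ξ, g ξ ∂(μ₀ : Measure (ℝ≥0 × ℝ≥0)))) := by
  -- `dampedMonoid` is closed under products, so the algebra it generates is its linear span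
  have hspan : g ∈ Submodule.span ℝ
      (dampedMonoid : Set (BoundedContinuousFunction (ℝ≥0 × ℝ≥0) ℝ)) := by
    have h1 : g ∈ Subalgebra.toSubmodule (Algebra.adjoin ℝ
      (dampedMonoid : Set (BoundedContinuousFunction (ℝ≥0 × ℝ≥0) ℝ))) := hg
    rwa [Algebra.adjoin_eq_span, Submonoid.closure_eq] at h1
  clear hg
  induction hspan using Submodule.span_induction with
  | mem g hg =>
    rcases hg with rfl | ⟨c, hc, a, b, hg⟩
    · simp
    · rw [hg]
      exact h.of_one hc a b
  | zero => simp
  | add g g' _ _ ih ih' =>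
    have hadd : ∀ ν : Measure (ℝ≥0 × ℝ≥0), IsFiniteMeasure ν →
        ∫ ξ, (g + g') ξ ∂ν = ∫ ξ, g ξ ∂ν + ∫ ξ, g' ξ ∂ν :=
      fun ν _ => integral_add (g.integrable ν) (g'.integrable ν)
    simp_rw [fun n => hadd (μ n) inferInstance, hadd μ₀ inferInstance]
    exact ih.add ih'
  | smul r g _ ih =>
    have hsmul : ∀ ν : Measure (ℝ≥0 × ℝ≥0), ∫ ξ, (r • g) ξ ∂ν = r * ∫ ξ, g ξ ∂ν :=
      fun ν => integral_const_mul r g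
    simp_rw [hsmul]
    exact ih.const_mul r

/-- Pointwise convergence of Poisson mixture densities implies weak convergence of the mixing
distributions. In particular the mixing distribution is identifiable. -/
theorem tendsto_of_tendsto_mixDensity
    (h : ∀ w, Tendsto (fun n => mixDensity (μ n) w) atTop (𝓝 (mixDensity μ₀ w))) :
    Tendsto μ atTop (𝓝 μ₀) := by
  have hm := momentsTendsto_one_of_mixDensity h
  refine ProbabilityMeasure.tendsto_of_tight_of_separatesPoints ℝ hm.isTightMeasureSet
    (A := dampedAlgebra) ?_ fun g hg => hm.tendsto_integral hg
  intro ξ η hne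
  by_contra hcon
  have heq : ∀ a b : ℕ, expMonomial 1 a b 0 ξ = expMonomial 1 a b 0 η := by
    intro a b
    obtain ⟨g, hg, hgc⟩ := exists_mem_dampedAlgebra one_pos a b
    by_contra hval
    refine hcon ⟨_, ⟨_, ⟨g, hg, rfl⟩, rfl⟩, ?_⟩
    change g ξ ≠ g η
    rwa [hgc]
  have h0 := heq 0 0
  have h1 := heq 1 0
  have h2 := heq 0 1
  simp only [expMonomial, pow_zero, pow_one, mul_one] at h0 h1 h2
  rw [h0] at h1 h2
  exact hne (Prod.ext (NNReal.coe_injective (mul_left_cancel₀ (Real.exp_ne_zero _) h1))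
    (NNReal.coe_injective (mul_left_cancel₀ (Real.exp_ne_zero _) h2)))

/-! ### Consistency for a fixed data sequence -/

/-- The relative frequency of `w` among the first `n` observations; for `n = 0` it is
`0 / 0 = 0`. -/
def empFreq (W : ℕ → ℕ × ℕ) (n : ℕ) (w : ℕ × ℕ) : ℝ :=
  (∑ i ∈ Finset.range n, ({w} : Set (ℕ × ℕ)).indicator (fun _ => (1 : ℝ)) (W i)) / n

/-- A bound on the empirical mean of `g ≥ 0`, restricted to the observations in a finite set `A`. -/
lemma sum_empFreq_mul_le {W : ℕ → ℕ × ℕ} {n : ℕ} {g : ℕ × ℕ → ℝ} (hg : ∀ w, 0 ≤ g w)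
    (h : ∑ i : Fin n, g (W i) ≤ n) (A : Finset (ℕ × ℕ)) : ∑ w ∈ A, empFreq W n w * g w ≤ 1 := by
  have hterm : ∀ i, ∑ w ∈ A, ({w} : Set (ℕ × ℕ)).indicator (fun _ => (1 : ℝ)) (W i) * g w ≤
      g (W i) := by
    intro i
    by_cases hi : W i ∈ A
    · rw [Finset.sum_eq_single_of_mem (W i) hi fun w _ hw => by
        rw [Set.indicator_of_notMem (by simpa using hw.symm), zero_mul]]
      simp
    · rw [Finset.sum_eq_zero fun w hw => by
        rw [Set.indicator_of_notMem (by rintro rfl; exact hi hw), zero_mul]]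
      exact hg _
  rw [Fin.sum_univ_eq_sum_range (fun i => g (W i)) n] at h
  calc ∑ w ∈ A, empFreq W n w * g w
      = (∑ i ∈ Finset.range n,
          ∑ w ∈ A, ({w} : Set (ℕ × ℕ)).indicator (fun _ => (1 : ℝ)) (W i) * g w) / n := by
        rw [Finset.sum_comm, Finset.sum_div]
        refine Finset.sum_congr rfl fun w _ => ?_
        rw [empFreq, ← Finset.sum_mul, div_mul_eq_mul_div]
    _ ≤ (∑ i ∈ Finset.range n, g (W i)) / n := by
        gcongr
        exact hterm _
    _ ≤ 1 := div_le_one_of_le₀ h (Nat.cast_nonneg n)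

lemma exists_of_empFreq_pos {W : ℕ → ℕ × ℕ} {n : ℕ} {w : ℕ × ℕ} (h : 0 < empFreq W n w) :
    ∃ i : Fin n, W i = w := by
  by_contra! hcon
  refine h.ne' ?_
  have h0 : ∀ i ∈ Finset.range n, ({w} : Set (ℕ × ℕ)).indicator (fun _ => (1 : ℝ)) (W i) = 0 :=
    fun i hi => Set.indicator_of_notMem (by simpa using hcon ⟨i, Finset.mem_range.1 hi⟩) _
  rw [empFreq, Finset.sum_eq_zero h0, zero_div]

/-- Consistency for every data sequence whose relative frequencies converge to the true density and
which has no observation of probability zero. -/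
theorem tendsto_of_isGMLE {W : ℕ → ℕ × ℕ} {Ghat : ℕ → ProbabilityMeasure (ℝ≥0 × ℝ≥0)}
    (hsum : HasSum (mixDensity μ₀) 1) (hpos : ∀ i, 0 < mixDensity μ₀ (W i))
    (hfreq : ∀ w, Tendsto (fun n => empFreq W n w) atTop (𝓝 (mixDensity μ₀ w)))
    (hG : ∀ n, IsGMLE (fun i : Fin n => W i) (Ghat n)) : Tendsto Ghat atTop (𝓝 μ₀) := by
  have hq : ∀ n (i : Fin n), 0 < mixDensity (Ghat n) (W i) :=
    fun n i => (hG n).mixDensity_pos (fun i => hpos i) i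
  refine tendsto_of_tendsto_mixDensity (tendsto_of_sum_mul_div_le (mixDensity_nonneg μ₀) hsum
    (fun n => mixDensity_nonneg (Ghat n)) (fun n => sum_mixDensity_le_one (Ghat n)) hfreq
    (fun n w hw => ?_) fun n A => ?_)
  · obtain ⟨i, rfl⟩ := exists_of_empFreq_pos hw
    exact hq n i
  · exact sum_empFreq_mul_le (g := fun w => mixDensity μ₀ w / mixDensity (Ghat n) w)
      (fun w => div_nonneg (mixDensity_nonneg _ _) (mixDensity_nonneg _ _))
      ((hG n).sum_div_le (hq n) μ₀) A

end PostStrat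

end

/-! ### The strong law and consistency -/

theorem mainTheorem2
    {Ω : Type*} [MeasurableSpace Ω] (P : Measure Ω) [IsProbabilityMeasure P]
    (G : ProbabilityMeasure (ℝ≥0 × I))
    (X K : ℕ → Ω → ℕ)
    (hindep : iIndepFun (fun i ω => (X i ω, K i ω)) P)
    (hlaw : ∀ i, HasLaw (fun ω => (X i ω, K i ω))
      ((G : Measure (ℝ≥0 × I)).bind PostStrat.obsKernel) P) :
    (∀ θ : ℝ≥0 × I, (PostStrat.obsKernel θ).map PostStrat.splitCounts =
      (poissonMeasure (PostStrat.reparam θ).1).prod (poissonMeasure (PostStrat.reparam θ).2)) ∧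
    ∀ Ghat : ℕ → Ω → ProbabilityMeasure (ℝ≥0 × ℝ≥0),
      (∀ n, ∀ᵐ ω ∂P, PostStrat.IsGMLE
        (fun i : Fin n => PostStrat.splitCounts (X i ω, K i ω)) (Ghat n ω)) →
      ∀ᵐ ω ∂P, Tendsto (fun n => Ghat n ω) atTop (𝓝 (PostStrat.mixingLaw G)) := by
  refine ⟨PostStrat.map_splitCounts_obsLaw, fun Ghat hG => ?_⟩
  set f := PostStrat.mixDensity (PostStrat.mixingLaw G) with hf
  let W : ℕ → Ω → ℕ × ℕ := fun i ω => PostStrat.splitCounts (X i ω, K i ω)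
  have hW : ∀ i, AEMeasurable (W i) P :=
    fun i => (Measurable.of_discrete (f := PostStrat.splitCounts)).comp_aemeasurable
      (hlaw i).aemeasurable
  have hlawW : ∀ i w, P {ω | W i ω = w} = ENNReal.ofReal (f w) := by
    intro i w
    rw [hf, ← PostStrat.bind_obsKernel_splitCounts]
    exact (hlaw i).measure_eq (p := fun y => PostStrat.splitCounts y = w) .of_discrete
  have hmap : ∀ i, P.map (W i) = P.map (W 0) := by
    intro i
    refine Measure.ext_of_singleton fun w => ?_
    rw [Measure.map_apply_of_aemeasurable (hW i) .of_discrete,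
      Measure.map_apply_of_aemeasurable (hW 0) .of_discrete]
    exact (hlawW i w).trans (hlawW 0 w).symm
  have hreal : ∀ w, (P.map (W 0)).real {w} = f w := by
    intro w
    rw [measureReal_def, Measure.map_apply_of_aemeasurable (hW 0) .of_discrete]
    change (P {ω | W 0 ω = w}).toReal = f w
    rw [hlawW, ENNReal.toReal_ofReal (PostStrat.mixDensity_nonneg _ w)]
  have : IsProbabilityMeasure (P.map (W 0)) := Measure.isProbabilityMeasure_map (hW 0)
  -- `f` is the law of `W 0`, hence a probability mass function
  have hsum : HasSum f 1 := by
    have h1 := Measure.tsum_indicator_apply_singleton (P.map (W 0)) Set.univ .univ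
    simp only [Set.indicator_univ, measure_univ] at h1
    have h2 := ENNReal.hasSum_toReal (f := fun w => P.map (W 0) {w}) (by simp [h1])
    rw [← ENNReal.tsum_toReal_eq fun w => measure_ne_top _ _, h1, ENNReal.toReal_one] at h2
    simpa only [← measureReal_def, hreal] using h2
  have hpos : ∀ᵐ ω ∂P, ∀ i, 0 < f (W i ω) := by
    rw [ae_all_iff]
    intro i
    have h0 : ∀ᵐ ω ∂P, ∀ w, f w = 0 → W i ω ≠ w := by
      rw [ae_all_iff]
      intro w
      by_cases hw : f w = 0
      · have : P {ω | W i ω = w} = 0 := by rw [hlawW, hw, ENNReal.ofReal_zero]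
        simpa [hw, ae_iff] using this
      · simp [hw]
    filter_upwards [h0] with ω hω
    exact (PostStrat.mixDensity_nonneg _ _).lt_of_ne' fun h => hω _ h rfl
  have hfreq : ∀ᵐ ω ∂P, ∀ w, Tendsto (fun n => PostStrat.empFreq (fun i => W i ω) n w) atTop
      (𝓝 (f w)) := by
    rw [ae_all_iff]
    intro w
    let φ : ℕ × ℕ → ℝ := ({w} : Set (ℕ × ℕ)).indicator fun _ => 1
    have hφ : Measurable φ := .of_discrete
    have hexp : ∫ ω, φ (W 0 ω) ∂P = f w := by
      rw [← integral_map (hW 0) hφ.aestronglyMeasurable, integral_indicator_const _ .of_discrete,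
        hreal]
      simp
    have hindW : iIndepFun W P :=
      hindep.comp (fun _ => PostStrat.splitCounts) fun _ => .of_discrete
    have hslln := strong_law_ae_real (μ := P) (fun i ω => φ (W i ω))
      (.of_bound (hφ.comp_aemeasurable (hW 0)).aestronglyMeasurable 1 (.of_forall fun ω => by
        by_cases h : W 0 ω = w <;> simp [φ, h]))
      (fun i j hij => (hindW.indepFun hij).comp hφ hφ)
      (fun i => IdentDistrib.comp ⟨hW i, hW 0, hmap i⟩ hφ)
    rw [hexp] at hslln
    exact hslln
  filter_upwards [hpos, hfreq, ae_all_iff.2 hG] with ω h1 h2 h3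
  exact PostStrat.tendsto_of_isGMLE hsum h1 h2 h3
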